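/- Let $R$ be an associative ring with $1$ and let $R\text{-Mod}$ be the category of left $R$-modules. An ideal of $R\text{-Mod}$ is a class of morphisms whose members $X\to Y$ form a subgroup of $\operatorname{Hom}_R(X,Y)$ for all $X,Y$, and which is closed under composition on either side with arbitrary morphisms. Let $\Psi$ be the FP-ghost ideal, that is, the ideal of all morphisms $f\colon X\to Y$ such that $\operatorname{Ext}^1_R(S,f)\colon \operatorname{Ext}^1_R(S,X)\to\operatorname{Ext}^1_R(S,Y)$ is zero for every finitely presented left $R$-module $S$. A left $R$-module $X$ is FP-injective if $\operatorname{Ext}^1_R(S,X)=0$ for every finitely presented left $R$-module $S$; let $\langle\mathcal{FI}\rangle$ be the ideal of all morphisms that factor through an FP-injective left $R$-module. For an ordinal $\lambda>0$, a $\lambda$-composition of morphisms in $\Psi$ is the morphism $A_0\to A_\lambda$ of a directed system $(A_\alpha)_{\alpha\le\lambda}$ of left $R$-modules such that $A_\beta=\varinjlim_{\alpha<\beta}A_\alpha$ for every limit ordinal $\beta\le\lambda$ and $A_\alpha\to A_{\alpha+1}$ lies in $\Psi$ for every $\alpha<\lambda$. Let $\Psi^{(\lambda)}$ be the ideal generated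 by all $\lambda$-compositions of morphisms in $\Psi$; for a positive integer $\lambda=n$ it is the ideal $\Psi^n$ generated by all compositions $f_n\cdots f_1$ with $f_1,\dots,f_n\in\Psi$. The Generalized $\lambda$-Generating Hypothesis $\lambda\text{-GGH}(\Psi)$ is the statement $\Psi^{(\lambda)}=\langle\mathcal{FI}\rangle$. **Proposition.** Let $n$ be a positive integer and let $R$ be a left artinian ring whose Jacobson radical $J$ satisfies $J^n=0$. Then $n\text{-GGH}(\Psi)$ holds, that is, $\Psi^{(n)}=\langle\mathcal{FI}\rangle$. -/

import Mathlib

open CategoryTheory CategoryTheory.Limits CategoryTheory.Abelian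

universe t w v u

namespace GhostGGH

section Ideals

variable {C : Type u} [Category.{v} C] [Preadditive C]

/-- A class of morphisms is an (additive, two-sided) ideal of a preadditive category `C` if its
members `X ⟶ Y` form a subgroup of `X ⟶ Y` for all `X`, `Y`, and it is closed under composition
with arbitrary morphisms of `C` on either side. -/
structure IsIdeal (I : MorphismProperty C) : Prop where
  zero_mem : ∀ X Y : C, I (0 : X ⟶ Y)
  sub_mem : ∀ {X Y : C} (f g : X ⟶ Y), I f → I g → I (f - g)
  comp_mem : ∀ {A X Y B : C} (f : A ⟶ X) (g : X ⟶ Y) (h : Y ⟶ B), I g → I (f ≫ g ≫ h)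

/-- The ideal generated by a class `W` of morphisms: the intersection of all ideals
containing `W`. -/
def idealSpan (W : MorphismProperty C) : MorphismProperty C :=
  fun _ _ f => ∀ I : MorphismProperty C, IsIdeal I → W ≤ I → I f

/-- The class of `lam`-compositions of morphisms in `J`: the composition morphisms
`A 0 ⟶ A lam` of continuous systems `(A α)`, `α ≤ lam`, all of whose maps `A α ⟶ A (α + 1)`,
`α < lam`, lie in `J`.  The index set `Set.Iic lam` of the ordinals `α ≤ lam` has a greatest
element, so that the colimit of the system is `A lam`. -/
def ordinalCompositions (J : MorphismProperty C) (lam : Ordinal.{t}) : MorphismProperty C :=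
  J.transfiniteCompositionsOfShape (Set.Iic lam)

/-- The `lam`-th inductive power of `J`: the ideal generated by all `lam`-compositions of
morphisms in `J`. -/
def inductivePower (J : MorphismProperty C) (lam : Ordinal.{t}) : MorphismProperty C :=
  idealSpan (ordinalCompositions J lam)

/-- The class of all morphisms that factor through an object satisfying `P`. -/
def factorsThrough (P : ObjectProperty C) : MorphismProperty C :=
  fun X Y f => ∃ (Z : C) (g : X ⟶ Z) (h : Z ⟶ Y), P Z ∧ g ≫ h = f

end Ideals

section Ghosts

variable {C : Type u} [Category.{v} C] [Abelian C] [HasExt.{w} C]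

/-- The ghost ideal of a class `S` of objects: the morphisms `f : X ⟶ Y` for which the map
`Ext¹(A, f) : Ext¹(A, X) → Ext¹(A, Y)` is zero for every `A` in `S`. -/
def ghost (S : ObjectProperty C) : MorphismProperty C :=
  fun X Y f => ∀ A : C, S A → ∀ e : Ext A X 1, e.comp (Ext.mk₀ f) (add_zero 1) = (0 : Ext A Y 1)

/-- The class of the objects `X` with `Ext¹(A, X) = 0` for every `A` in `S`. -/
def extPerp (S : ObjectProperty C) : ObjectProperty C :=
  fun X => ∀ A : C, S A → ∀ e : Ext A X 1, e = 0

/-- The Generalized `lam`-Generating Hypothesis for the ghost ideal of `S`: the `lam`-th inductive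
power of the ghost ideal of `S` is the ideal of the morphisms that factor through an object of
`extPerp S`. -/
def GGH (S : ObjectProperty C) (lam : Ordinal.{t}) : Prop :=
  inductivePower (ghost S) lam = factorsThrough (extPerp S)

end Ghosts

/-- The class of finitely presented left `R`-modules. Its ghost ideal is the FP-ghost ideal `Ψ`,
and `extPerp` of it is the class of FP-injective left `R`-modules. -/
def finitelyPresented (R : Type u) [Ring R] : ObjectProperty (ModuleCat.{u} R) :=
  fun M => Module.FinitePresentation R M

end GhostGGH

namespace GhostGGH

section Preadditive

variable {C : Type u} [Category.{v} C]

/-! For FP-injective `Z` the identity of `Z` is a ghost, hence a `lam`-composition of ghosts for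
every `lam`; this gives one inclusion. Conversely, a left artinian ring is left noetherian, so
simple modules are finitely presented. As vanishing in `Ext¹` out of a coproduct is tested on the
summands, a ghost kills `Ext¹` out of every semisimple module. The radical filtration of a module
`M` has semisimple factors, so by induction along `0 → JM → M → M/JM → 0` a composition of `n`
ghosts kills `Ext¹(M, -)` for every `M` (`ext_comp_map_eq_zero`). Taking `M = E/X` with `X ⊆ E`
injective, the composition extends over `E`, which is FP-injective. -/

/-- The identity of `Z` is a `lam`-composition of identities of `Z`. -/
lemma ordinalCompositions_id {W : MorphismProperty C} {Z : C} (hZ : W (𝟙 Z))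
    (lam : Ordinal.{t}) : ordinalCompositions W lam (𝟙 Z) := by
  refine ⟨{
    F := (Functor.const (Set.Iic lam)).obj Z
    isoBot := Iso.refl Z
    isWellOrderContinuous := ⟨fun m hm => ?_⟩
    incl := 𝟙 _
    isColimit := ?_
    fac := by simp
    map_mem := fun _ _ => hZ }⟩
  -- A limit stage has `⊥` below it, so a cocone on the constant system is determined by its leg at
  -- `⊥`.
  · have hbot : (⊥ : Set.Iic lam) < m := bot_lt_iff_ne_bot.2 hm.ne_bot
    refine ⟨{
      desc := fun s => s.ι.app ⟨⊥, hbot⟩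
      fac := fun s j => ?_
      uniq := fun s f hf => ?_ }⟩
    · have := s.ι.naturality (homOfLE (show (⟨⊥, hbot⟩ : Set.Iio m) ≤ j from bot_le (a := j.1)))
      exact (Category.id_comp _).trans
        ((this.trans (Category.comp_id _)).symm.trans (Category.id_comp _))
    · exact (Category.id_comp f).symm.trans (hf ⟨⊥, hbot⟩)
  · exact {
      desc := fun s => s.ι.app ⊥
      fac := fun s j => by
        have := s.ι.naturality (homOfLE bot_le : (⊥ : Set.Iic lam) ⟶ j)
        simp at this ⊢
        exact this.symm
      uniq := fun s f hf => by simpa using hf ⊥ }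

variable [Preadditive C]

open scoped ZeroObject in
lemma isIdeal_factorsThrough [HasZeroObject C] [HasBinaryBiproducts C] {P : ObjectProperty C}
    (h0 : P (0 : C)) (hP : ∀ Z Z' : C, P Z → P Z' → P (Z ⊞ Z')) : IsIdeal (factorsThrough P) where
  zero_mem X Y := ⟨(0 : C), 0, 0, h0, by simp⟩
  sub_mem := by
    rintro X Y _ _ ⟨Z, a, b, hZ, rfl⟩ ⟨Z', a', b', hZ', rfl⟩
    exact ⟨Z ⊞ Z', biprod.lift a a', biprod.desc b (-b'), hP _ _ hZ hZ', by
      simp [biprod.lift_desc, sub_eq_add_neg]⟩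
  comp_mem := by
    rintro A X Y B f _ h ⟨Z, a, b, hZ, rfl⟩
    exact ⟨Z, f ≫ a, b ≫ h, hZ, by simp⟩

end Preadditive

section Abelian

variable {C : Type u} [Category.{v} C] [Abelian C]

/-- The short exact sequence `0 ⟶ X ⟶ E ⟶ E / X ⟶ 0` with `E` the chosen injective object
containing `X`. -/
lemma shortExact_under [EnoughInjectives C] (X : C) :
    (ShortComplex.mk (Injective.ι X) (cokernel.π (Injective.ι X))
      (cokernel.condition _)).ShortExact where
  exact := ShortComplex.exact_cokernel _
  mono_f := inferInstanceAs (Mono (Injective.ι X))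
  epi_g := inferInstanceAs (Epi (cokernel.π _))

variable [HasExt.{w} C]

open scoped ZeroObject in
lemma extPerp_zero (S : ObjectProperty C) : extPerp S (0 : C) := fun A _ e => by
  have h : (𝟙 (0 : C)) = 0 := (isZero_zero C).eq_of_src _ _
  rw [← e.comp_mk₀_id, h, Ext.mk₀_zero, Ext.comp_zero]

lemma extPerp_biprod {S : ObjectProperty C} {Z Z' : C} (hZ : extPerp S Z) (hZ' : extPerp S Z') :
    extPerp S (Z ⊞ Z') := fun A hA e => by
  have h := hZ A hA (e.comp (Ext.mk₀ biprod.fst) (add_zero 1))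
  have h' := hZ' A hA (e.comp (Ext.mk₀ biprod.snd) (add_zero 1))
  rw [← e.comp_mk₀_id, ← biprod.total, Ext.mk₀_add, Ext.comp_add, ← Ext.mk₀_comp_mk₀,
    ← Ext.mk₀_comp_mk₀, ← Ext.comp_assoc_of_third_deg_zero, ← Ext.comp_assoc_of_third_deg_zero,
    h, h', Ext.zero_comp, Ext.zero_comp, add_zero]

lemma extPerp_of_injective (S : ObjectProperty C) (Z : C) [Injective Z] : extPerp S Z :=
  fun _ _ e => e.eq_zero_of_injective

lemma isIdeal_factorsThrough_extPerp (S : ObjectProperty C) :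
    IsIdeal (factorsThrough (extPerp S)) :=
  isIdeal_factorsThrough (extPerp_zero S) fun _ _ => extPerp_biprod

lemma factorsThrough_extPerp_le_inductivePower (S : ObjectProperty C) (lam : Ordinal.{t}) :
    factorsThrough (extPerp S) ≤ inductivePower (ghost S) lam := by
  rintro X Y _ ⟨Z, g, h, hZ, rfl⟩ I hI hW
  rw [← Category.id_comp h]
  exact hI.comp_mem g (𝟙 Z) h (hW _ (ordinalCompositions_id (fun A hA e => by
    rw [hZ A hA e, Ext.zero_comp]) lam))

/-- A morphism that induces zero on `Ext¹(M, -)` for all `M` factors through an injective. -/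
lemma exists_factor_injective [EnoughInjectives C] {X Y : C} (f : X ⟶ Y)
    (hf : ∀ (M : C) (e : Ext M X 1), e.comp (Ext.mk₀ f) (add_zero 1) = 0) :
    ∃ g : Injective.under X ⟶ Y, Injective.ι X ≫ g = f := by
  -- The obstruction to extending `f` along `Injective.ι X` is the pushforward by `f` of the class
  -- of this extension.
  obtain ⟨x, hx⟩ := Ext.contravariant_sequence_exact₁ (shortExact_under X) Y (Ext.mk₀ f)
    (add_zero 1) (hf _ _)
  obtain ⟨g, rfl⟩ := (Ext.mk₀_bijective _ _).2 x
  rw [Ext.mk₀_comp_mk₀] at hx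
  exact ⟨g, (Ext.mk₀_bijective _ _).1 hx⟩

/-- A class in `Ext¹` of a coproduct vanishes if all its restrictions to the summands do. -/
lemma ext_one_eq_zero_of_isColimit_cofan [EnoughInjectives C] {ι : Type t} {A : ι → C}
    {c : Cofan A} (hc : IsColimit c) {Y : C} (e : Ext c.pt Y 1)
    (he : ∀ i, (Ext.mk₀ (c.inj i)).comp e (zero_add 1) = 0) : e = 0 := by
  have hS := shortExact_under Y
  obtain ⟨x, rfl⟩ := Ext.covariant_sequence_exact₁ c.pt hS e (Ext.eq_zero_of_injective _) (zero_add 1)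
  obtain ⟨g, rfl⟩ := (Ext.mk₀_bijective _ _).2 x
  have hl : ∀ i, ∃ l : A i ⟶ Injective.under Y, l ≫ cokernel.π (Injective.ι Y) = c.inj i ≫ g := by
    intro i
    obtain ⟨y, hy⟩ := Ext.covariant_sequence_exact₃ (A i) hS (Ext.mk₀ (c.inj i ≫ g)) (zero_add 1)
      (by rw [← Ext.mk₀_comp_mk₀, ← he i, Ext.comp_assoc_of_second_deg_zero])
    obtain ⟨l, rfl⟩ := (Ext.mk₀_bijective _ _).2 y
    rw [Ext.mk₀_comp_mk₀] at hy
    exact ⟨l, (Ext.mk₀_bijective _ _).1 hy⟩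
  choose l hl using hl
  -- The lifts on the summands glue to a lift of `g`, whose image under the connecting map is `e`.
  have hg : Cofan.IsColimit.desc hc l ≫ cokernel.π (Injective.ι Y) = g :=
    Cofan.IsColimit.hom_ext hc _ _ fun i => by simp [hl]
  have hz := hS.comp_extClass
  dsimp only at hz
  rw [← hg, ← Ext.mk₀_comp_mk₀, Ext.comp_assoc_of_second_deg_zero, hz, Ext.comp_zero]

/-- If `f` kills `Ext¹(A', -)` and `g` kills `Ext¹(A'', -)`, then `f ≫ g` kills `Ext¹(A, -)` for
every extension `A` of `A''` by `A'`. -/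
lemma ext_comp_eq_zero_of_shortExact {S : ShortComplex C} (hS : S.ShortExact) {X Y Z : C}
    (f : X ⟶ Y) (g : Y ⟶ Z)
    (hf : ∀ e : Ext S.X₁ X 1, e.comp (Ext.mk₀ f) (add_zero 1) = 0)
    (hg : ∀ e : Ext S.X₃ Y 1, e.comp (Ext.mk₀ g) (add_zero 1) = 0) (e : Ext S.X₂ X 1) :
    e.comp (Ext.mk₀ (f ≫ g)) (add_zero 1) = 0 := by
  -- After `f` the class restricts to zero on `S.X₁`, so it comes from `S.X₃`, where `g` kills it.
  obtain ⟨x, hx⟩ := Ext.contravariant_sequence_exact₂ hS Y (e.comp (Ext.mk₀ f) (add_zero 1)) (by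
    rw [← Ext.comp_assoc_of_third_deg_zero, hf])
  rw [← Ext.mk₀_comp_mk₀, ← Ext.comp_assoc_of_third_deg_zero, ← hx,
    Ext.comp_assoc_of_third_deg_zero, hg, Ext.comp_zero]

end Abelian

section Modules

variable {R : Type u} [Ring R]

lemma finitelyPresented_of_isSimpleModule [IsNoetherianRing R] (M : ModuleCat.{u} R)
    [IsSimpleModule R M] : finitelyPresented R M :=
  Module.finitePresentation_of_finite R M

/-- Over a left noetherian ring, ghosts induce zero on `Ext¹(M, -)` for all semisimple `M`. -/
lemma ghost_ext_comp_eq_zero_of_isSemisimpleModule [IsNoetherianRing R] {X Y : ModuleCat.{u} R}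
    {f : X ⟶ Y} (hf : ghost (finitelyPresented R) f) (M : ModuleCat.{u} R) [IsSemisimpleModule R M]
    (e : Ext M X 1) : e.comp (Ext.mk₀ f) (add_zero 1) = 0 := by
  classical
  obtain ⟨s, φ, hs⟩ := IsSemisimpleModule.exists_linearEquiv_dfinsupp R M
  let c : Cofan fun m : s => ModuleCat.of R m.1 :=
    Cofan.mk M fun m => ModuleCat.ofHom (φ.symm.toLinearMap ∘ₗ DFinsupp.lsingle (M := fun m : s => m.1) m)
  have hc : IsColimit c := Cofan.IsColimit.mk c
    (fun t => ModuleCat.ofHom ((DFinsupp.lsum ℕ fun m => (t.inj m).hom) ∘ₗ φ.toLinearMap))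
    (fun t m => by
      ext x
      simp [c, Cofan.inj])
    (fun t g hg => by
      ext x
      obtain ⟨y, rfl⟩ := φ.symm.surjective x
      have : g.hom ∘ₗ φ.symm.toLinearMap = DFinsupp.lsum ℕ fun m => (t.inj m).hom := by
        ext m x
        simpa [c, Cofan.inj] using LinearMap.congr_fun (congrArg ModuleCat.Hom.hom (hg m)) x
      simpa using LinearMap.congr_fun this y)
  refine ext_one_eq_zero_of_isColimit_cofan hc _ fun m => ?_
  have := hs.2 m
  rw [← Ext.comp_assoc_of_third_deg_zero]
  exact hf _ (finitelyPresented_of_isSimpleModule _) _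

/-- The quotient is a module over the semisimple ring `R/J`, with the same submodules. -/
lemma isSemisimpleModule_quotient_jacobson_smul [IsSemiprimaryRing R] (M : Type w) [AddCommGroup M]
    [Module R M] : IsSemisimpleModule R (M ⧸ (Ring.jacobson R • ⊤ : Submodule R M)) := by
  have h : Module.IsTorsionBySet R (M ⧸ (Ring.jacobson R • ⊤ : Submodule R M))
      (Ring.jacobson R) :=
    (Module.isTorsionBySet_quotient_iff _ _).2 fun m i hi => Submodule.smul_mem_smul hi trivial
  let _ := h.module
  have := IsSemiprimaryRing.isSemisimpleRing (R := R)
  exact (h.semilinearMap.isSemisimpleModule_iff_of_bijective Function.bijective_id).2 inferInstance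

lemma pow_smul_top_jacobson_smul (k : ℕ) (M : Type w) [AddCommGroup M] [Module R M]
    (h : (Ring.jacobson R ^ (k + 1) • ⊤ : Submodule R M) = ⊥) :
    (Ring.jacobson R ^ k • ⊤ :
      Submodule R (Ring.jacobson R • ⊤ : Submodule R M)) = ⊥ := by
  rwa [← Submodule.le_annihilator_iff, Submodule.annihilator_top,
    Submodule.le_annihilator_iff, ← Submodule.mul_smul, ← Submodule.pow_succ]

lemma shortExact_subtype_mkQ {M : ModuleCat.{u} R} (N : Submodule R M) :
    (ShortComplex.mk (ModuleCat.ofHom N.subtype) (ModuleCat.ofHom N.mkQ)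
      (by ext; simp)).ShortExact where
  exact := (ShortComplex.ShortExact.moduleCat_exact_iff_function_exact _).2
    (LinearMap.exact_subtype_mkQ N)
  mono_f := (ModuleCat.mono_iff_injective _).2 N.subtype_injective
  epi_g := (ModuleCat.epi_iff_surjective _).2 N.mkQ_surjective

/-- The composition of the first `k` maps of a system of ghosts over a left artinian ring induces
zero on `Ext¹(M, -)` for all modules `M` annihilated by the `k`-th power of the radical. -/
lemma ext_comp_map_eq_zero [IsArtinianRing R] {lam : Ordinal.{t}} (F : Set.Iic lam ⥤ ModuleCat.{u} R)
    (hF : ∀ j : Set.Iic lam, ¬ IsMax j →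
      ghost (finitelyPresented R) (F.map (homOfLE (Order.le_succ j))))
    (k : ℕ) : ∀ (j : Set.Iic lam), (j : Ordinal.{t}) = k → ∀ M : ModuleCat.{u} R,
    (Ring.jacobson R ^ k • ⊤ : Submodule R M) = ⊥ → ∀ e : Ext M (F.obj ⊥) 1,
      e.comp (Ext.mk₀ (F.map (homOfLE bot_le : ⊥ ⟶ j))) (add_zero 1) = 0 := by
  induction k with
  | zero =>
    intro j _ M hM e
    have hM' : Subsingleton M := by
      rw [Submodule.pow_zero, Ideal.one_eq_top, Submodule.top_smul] at hM
      exact (Submodule.subsingleton_iff R).1 (subsingleton_of_bot_eq_top hM.symm)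
    rw [← e.mk₀_id_comp, (ModuleCat.isZero_of_subsingleton M).eq_of_src (𝟙 M) 0, Ext.mk₀_zero,
      Ext.zero_comp, Ext.zero_comp]
  | succ k ih =>
    intro j hj M hM e
    have hlt : (k : Ordinal.{t}) < j := by rw [hj]; exact_mod_cast k.lt_succ_self
    obtain ⟨i, hik⟩ : ∃ i : Set.Iic lam, (i : Ordinal.{t}) = k := ⟨⟨k, hlt.le.trans j.2⟩, rfl⟩
    have hij : i < j := by rwa [← Subtype.coe_lt_coe, hik]
    have hi : ¬ IsMax i := not_isMax_of_lt hij
    -- The successor in `Set.Iic lam` fixes the top; it agrees with the ordinal successor here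
    -- because `i` is not maximal.
    obtain rfl : j = Order.succ i := by
      refine le_antisymm ?_ (Order.succ_le_of_lt hij)
      have h : (i : Ordinal.{t}) < (Order.succ i : Set.Iic lam) :=
        Order.lt_succ_of_not_isMax hi
      rw [hik] at h
      rw [← Subtype.coe_le_coe, hj, Nat.cast_succ]
      exact Order.add_one_le_of_lt h
    have hmap : F.map (homOfLE bot_le : ⊥ ⟶ Order.succ i) =
        F.map (homOfLE bot_le : ⊥ ⟶ i) ≫ F.map (homOfLE (Order.le_succ i)) := by
      rw [← F.map_comp]; rfl
    rw [hmap]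
    have := isSemisimpleModule_quotient_jacobson_smul (R := R) M
    exact ext_comp_eq_zero_of_shortExact (shortExact_subtype_mkQ _) _ _
      (ih i hik _ (pow_smul_top_jacobson_smul k M hM))
      (ghost_ext_comp_eq_zero_of_isSemisimpleModule (hF i hi) (ModuleCat.of R _)) e

lemma ordinalCompositions_ghost_le [IsArtinianRing R] (n : ℕ) (hJ : Ring.jacobson R ^ n = ⊥) :
    ordinalCompositions (ghost (finitelyPresented R)) (n : Ordinal.{t}) ≤
      factorsThrough (extPerp (finitelyPresented R)) := by
  rintro X Y f ⟨h⟩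
  obtain ⟨g, hg⟩ := exists_factor_injective (h.F.map (homOfLE bot_le : ⊥ ⟶ ⊤)) fun M e =>
    ext_comp_map_eq_zero h.F h.map_mem n ⊤ rfl M (by rw [hJ, Submodule.bot_smul]) e
  refine ⟨_, h.isoBot.inv ≫ Injective.ι _, g ≫ h.incl.app ⊤, extPerp_of_injective _ _, ?_⟩
  rw [Category.assoc, reassoc_of% hg, h.incl.naturality]
  exact (congrArg _ (Category.comp_id _)).trans h.fac

end Modules

end GhostGGH

theorem proposition8p7 {R : Type u} [Ring R] [IsArtinianRing R] (n : ℕ) (hn : 0 < n)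
    (hJ : Ring.jacobson R ^ n = ⊥) :
    GhostGGH.GGH (GhostGGH.finitelyPresented R) (n : Ordinal.{0}) :=
  le_antisymm
    (fun _ _ _ hf => hf _ (GhostGGH.isIdeal_factorsThrough_extPerp _)
      (GhostGGH.ordinalCompositions_ghost_le n hJ))
    (GhostGGH.factorsThrough_extPerp_le_inductivePower _ _)
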